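/- Let $s\ge 1$ and let $\Xi\in\mathbb Z^{s\times s}$ be expansive, i.e. all its complex eigenvalues have modulus greater than $1$. Let $\Xi=\Theta_1\Sigma\Theta_2$ be a Smith factorization, i.e. $\Theta_1,\Theta_2\in\mathbb Z^{s\times s}$ are unimodular and $\Sigma=\operatorname{diag}(\sigma_1,\dots,\sigma_s)$ is an integer diagonal matrix, and suppose that $\Theta_2\Theta_1=I$, i.e. $\Xi=\Theta_1\Sigma\Theta_1^{-1}$. Terminology. All functions and sequences are real valued. For an expansive integer matrix $A\in\mathbb Z^{n\times n}$ and $f\in L_2(\mathbb R^n)$ let $V_j(f)$, $j\in\mathbb Z$, be the closed linear span in $L_2(\mathbb R^n)$ of $\{f(A^j\cdot-\alpha):\alpha\in\mathbb Z^n\}$. We say that $f$ generates an orthogonal multiresolution analysis (MRA) of $L_2(\mathbb R^n)$ with respect to the dilation $A$ if $\int f(x)f(x-\gamma)\,dx=\delta_{\gamma,0}$ for all $\gamma\in\mathbb Z^n$, $V_j(f)\subseteq V_{j+1}(f)$ for all $j$, $\bigcup_jV_j(f)$ is dense in $L_2(\mathbb R^n)$ and $\bigcap_jV_j(f)=\{0\}$.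 The function $f$ is refinable with mask $a$, where $a:\mathbb Z^n\to\mathbb R$ is finitely supported, if $f=\sum_\alpha a(\alpha)f(A\cdot-\alpha)$ almost everywhere. Functions $\psi_k\in L_2(\mathbb R^n)$, $k\in K$, are orthonormal wavelets for the MRA generated by $f$ if $\int f(x-\gamma)\psi_k(x)\,dx=0$ and $\int\psi_k(x)\psi_l(x-\gamma)\,dx=\delta_{k,l}\,\delta_{\gamma,0}$ for all $k,l\in K$, $\gamma\in\mathbb Z^n$, and if for every $j\in\mathbb Z$ the closed linear span of $\{\psi_k(A^j\cdot-\alpha):k\in K,\ \alpha\in\mathbb Z^n\}$ is $V_{j+1}(f)\ominus V_j(f)$, the orthogonal complement of $V_j(f)$ in $V_{j+1}(f)$. For $j=1,\dots,s$ let $\phi_{\sigma_j}\in L_2(\mathbb R)$ be a univariate orthogonal scaling function for the dilation $\sigma_j$, that is, $\phi_{\sigma_j}$ is refinable with a finitely supported mask $h_j$ and generates an orthogonal MRA of $L_2(\mathbb R)$ with respect to the dilation $\sigma_j$. Let $g_j^0=h_j$ and let $g_j^k:\mathbb Z\to\mathbb R$, $0\ne k\in\mathbb Z/\sigma_j\mathbb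 Z$, be associated orthogonal wavelet filters, that is, finitely supported filters such that $$\sum_{\alpha\in\mathbb Z}g_j^k(\alpha)\,g_j^l(\alpha-\sigma_j\gamma)=|\sigma_j|\,\delta_{k,l}\,\delta_{\gamma,0},\qquad k,l\in\mathbb Z/\sigma_j\mathbb Z,\ \gamma\in\mathbb Z.$$ Put $\tilde\phi(x)=\prod_{j=1}^s\phi_{\sigma_j}(x_j)$ and $\phi=\tilde\phi(\Theta_1^{-1}\cdot)$, and for $\eta\in\mathbb Z_\Sigma:=\prod_{j=1}^s\mathbb Z/\sigma_j\mathbb Z$ put $$g_\eta(\alpha)=\prod_{j=1}^s g_j^{\eta_j}(\alpha_j),\qquad b_\eta=g_\eta(\Theta_1^{-1}\cdot),\qquad \psi_\eta=\sum_{\alpha\in\mathbb Z^s}b_\eta(\alpha)\,\phi(\Xi\cdot-\alpha).$$ Then $\phi$ is refinable with mask $b_0$ with respect to $\Xi$ (that is, $\psi_0=\phi$ almost everywhere), $\phi$ generates an orthogonal MRA of $L_2(\mathbb R^s)$ with respect to the dilation $\Xi$, and the $|\det\Xi|-1$ functions $\psi_\eta$, $\eta\in\mathbb Z_\Sigma\setminus\{0\}$,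 are orthonormal wavelets for this MRA. -/

import Mathlib

open MeasureTheory Matrix

noncomputable section

/-! ### Multiresolution analyses and wavelets

The notions below are used both on `ℝ` (lattice `ℤ`, dilation `x ↦ σ x`) and on `ℝ^s`
(lattice `ℤ^s`, dilation `x ↦ Ξ x`). So they are stated for a space `E`, a lattice embedded by
`emb : G → E`, and `D : ℤ → E → E`, where `D j` is the `j`-th power of the dilation. -/

section MRA

variable {E G K : Type*} [MeasureSpace E] [AddCommGroup E]

/-- The closed linear span in `L₂(E)` of the functions `Φ k (D j · - α)`, for `k` in the index
set and `α` in the lattice. -/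
def dilatedSpan (D : ℤ → E → E) (emb : G → E) (Φ : K → E → ℝ) (j : ℤ) :
    Submodule ℝ (Lp ℝ 2 (volume : Measure E)) :=
  (Submodule.span ℝ {f : Lp ℝ 2 (volume : Measure E) |
    ∃ (k : K) (α : G), f =ᵐ[volume] fun x => Φ k (D j x - emb α)}).topologicalClosure

/-- The space `V_j` spanned by the translates of `φ` at level `j`. -/
def scalingSpace (D : ℤ → E → E) (emb : G → E) (φ : E → ℝ) (j : ℤ) :
    Submodule ℝ (Lp ℝ 2 (volume : Measure E)) :=
  dilatedSpan D emb (fun _ : Unit => φ) j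

/-- The function `∑_α b(α) φ(D · - α)`, for a finitely supported filter `b`. -/
def filteredFunction (D : ℤ → E → E) (emb : G → E) (b : G → ℝ) (φ : E → ℝ) : E → ℝ :=
  fun x => ∑ᶠ α : G, b α * φ (D 1 x - emb α)

/-- `φ` is refinable with respect to the finitely supported mask `a`. -/
def IsRefinable (D : ℤ → E → E) (emb : G → E) (a : G → ℝ) (φ : E → ℝ) : Prop :=
  a.support.Finite ∧ φ =ᵐ[volume] filteredFunction D emb a φ

/-- `φ` generates an orthogonal multiresolution analysis of `L₂(E)`. -/
structure IsOrthogonalMRA [Zero G] [DecidableEq G] (D : ℤ → E → E) (emb : G → E)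
    (φ : E → ℝ) : Prop where
  memLp : MemLp φ 2 (volume : Measure E)
  orthonormal : ∀ γ : G, ∫ x, φ x * φ (x - emb γ) = if γ = 0 then 1 else 0
  nested : ∀ j : ℤ, scalingSpace D emb φ j ≤ scalingSpace D emb φ (j + 1)
  dense : (⨆ j : ℤ, scalingSpace D emb φ j).topologicalClosure = ⊤
  separated : ⨅ j : ℤ, scalingSpace D emb φ j = ⊥

/-- The `ψ k` are orthonormal wavelets for the multiresolution analysis generated by `φ`:
their translates are orthonormal and orthogonal to those of `φ`, and at each level `j` their
translates and dilates span `W_j`, the orthogonal complement of `V_j` in `V_{j+1}`. -/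
structure IsOrthonormalWavelets [Zero G] [DecidableEq G] [DecidableEq K] (D : ℤ → E → E)
    (emb : G → E) (φ : E → ℝ) (ψ : K → E → ℝ) : Prop where
  memLp : ∀ k, MemLp (ψ k) 2 (volume : Measure E)
  orthogonal_scaling : ∀ (k : K) (γ : G), ∫ x, φ (x - emb γ) * ψ k x = 0
  orthonormal : ∀ (k l : K) (γ : G),
    ∫ x, ψ k x * ψ l (x - emb γ) = if k = l ∧ γ = 0 then 1 else 0
  complement : ∀ j : ℤ, dilatedSpan D emb ψ j =
    scalingSpace D emb φ (j + 1) ⊓ (scalingSpace D emb φ j)ᗮ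

end MRA

/-! ### The univariate ingredients -/

/-- Powers of the dilation `x ↦ σ x` of `ℝ`. -/
def dil (σ : ℤ) (j : ℤ) (x : ℝ) : ℝ := (σ : ℝ) ^ j * x

/-- `φ` is a univariate orthogonal scaling function for the dilation `σ`, with the finitely
supported mask `h`. -/
def IsOrthogonalScalingFunction (σ : ℤ) (h : ℤ → ℝ) (φ : ℝ → ℝ) : Prop :=
  IsRefinable (dil σ) (fun n : ℤ => (n : ℝ)) h φ ∧
    IsOrthogonalMRA (dil σ) (fun n : ℤ => (n : ℝ)) φ

/-- `g k`, `k ≠ 0`, are orthogonal wavelet filters associated with the mask `h = g 0` for the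
dilation `σ`: finitely supported filters, which together with `h` satisfy the quadrature mirror
filter identity. -/
structure IsWaveletFilterSystem (σ : ℤ) (h : ℤ → ℝ) (g : ZMod σ.natAbs → ℤ → ℝ) : Prop where
  lowpass : g 0 = h
  finite_support : ∀ k, (g k).support.Finite
  qmf : ∀ (k l : ZMod σ.natAbs) (γ : ℤ),
    ∑ᶠ α : ℤ, g k α * g l (α - σ * γ) = if k = l ∧ γ = 0 then |(σ : ℝ)| else 0

/-! ### The multivariate construction -/

section Multivariate

variable {s : ℕ}

/-- All complex eigenvalues of `Ξ` are greater than one in modulus. -/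
def IsExpansive (Ξ : Matrix (Fin s) (Fin s) ℤ) : Prop :=
  ∀ μ ∈ spectrum ℂ (Ξ.map (Int.cast : ℤ → ℂ)), 1 < ‖μ‖

/-- `Ξ = Θ₁ Σ Θ₂` with `Θ₁`, `Θ₂` unimodular and `Σ` diagonal with the Smith values `σ`. -/
structure IsSmithFactorization (Ξ Θ₁ : Matrix (Fin s) (Fin s) ℤ) (σ : Fin s → ℤ)
    (Θ₂ : Matrix (Fin s) (Fin s) ℤ) : Prop where
  eq : Ξ = Θ₁ * Matrix.diagonal σ * Θ₂
  unimodular_left : |Θ₁.det| = 1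
  unimodular_right : |Θ₂.det| = 1

/-- Powers of the dilation `x ↦ Ξ x` of `ℝ^s`. -/
def matDil (Ξ : Matrix (Fin s) (Fin s) ℤ) (j : ℤ) (x : Fin s → ℝ) : Fin s → ℝ :=
  (Ξ.map (Int.cast : ℤ → ℝ) ^ j) *ᵥ x

/-- The embedding of `ℤ^s` in `ℝ^s`. -/
def latticeEmb (α : Fin s → ℤ) : Fin s → ℝ := fun i => (α i : ℝ)

/-- The tensor product of univariate functions. -/
def tensorFunction (φ : Fin s → ℝ → ℝ) (x : Fin s → ℝ) : ℝ := ∏ j, φ j (x j)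

/-- The function `φ̃(Θ₁⁻¹ ·)`, where `φ̃` is the tensor product of the `φ j`. -/
def smithScalingFunction (Θ₁ : Matrix (Fin s) (Fin s) ℤ) (φ : Fin s → ℝ → ℝ)
    (x : Fin s → ℝ) : ℝ :=
  tensorFunction φ ((Θ₁⁻¹).map (Int.cast : ℤ → ℝ) *ᵥ x)

/-- The tensor product filter `g_η = g_1^{η_1} ⊗ ⋯ ⊗ g_s^{η_s}`. -/
def tensorFilter {σ : Fin s → ℤ} (g : ∀ j, ZMod (σ j).natAbs → ℤ → ℝ)
    (η : ∀ j, ZMod (σ j).natAbs) (α : Fin s → ℤ) : ℝ :=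
  ∏ j, g j (η j) (α j)

/-- The filter `b_η = g_η(Θ₁⁻¹ ·)`. -/
def smithFilter (Θ₁ : Matrix (Fin s) (Fin s) ℤ) {σ : Fin s → ℤ}
    (g : ∀ j, ZMod (σ j).natAbs → ℤ → ℝ) (η : ∀ j, ZMod (σ j).natAbs) (α : Fin s → ℤ) : ℝ :=
  tensorFilter g η (Θ₁⁻¹ *ᵥ α)

/-- The function `ψ_η = ∑_α b_η(α) φ(Ξ · - α)`. -/
def smithWavelet (Ξ Θ₁ : Matrix (Fin s) (Fin s) ℤ) {σ : Fin s → ℤ} (φ : Fin s → ℝ → ℝ)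
    (g : ∀ j, ZMod (σ j).natAbs → ℤ → ℝ) (η : ∀ j, ZMod (σ j).natAbs) : (Fin s → ℝ) → ℝ :=
  filteredFunction (matDil Ξ) latticeEmb (smithFilter Θ₁ g η) (smithScalingFunction Θ₁ φ)

end Multivariate

end

/-! Since Θ₂ = Θ₁⁻¹, the relation Θ₂ Ξ = Σ Θ₂ makes Ξ act diagonally in the coordinates Θ₂ x, and
this change of coordinates preserves Lebesgue measure and the lattice. In these coordinates φ and
every ψ_η are tensor products, so everything reduces to tensor products of univariate MRAs, each
with its own dilation (`DiagonalCoordinates`). Expansiveness serves only to give det Ξ ≠ 0; density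
and separation are inherited from the factors.

In one variable, the filter identity says that the polyphase matrix has a one-sided inverse. The
matrix is square over a commutative ring, so the inverse is two-sided
(`IsWaveletFilterSystem.reconstruction`), and V_{j+1} is the closed span of all |σ| filtered
families at level j (`dilatedSpan_filteredFunction_eq`).

The tensor product `tensorLp` is continuous, multilinear and multiplicative for inner products.
Inclusions therefore pass from generators to closed spans, and totality of the pure tensors
(`eq_zero_of_inner_tensorLp_eq_zero`) yields density and, through an adjoint, trivial intersection.
Expanding each factor of a generator of V_{j+1} gives products indexed by η: η = 0 lands in V_j,
every other η in the wavelet space. These two spaces are orthogonal, so the wavelet space is the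
whole complement. -/

noncomputable section

/-! ### Perfect reconstruction from the quadrature mirror filter identity -/

section Filters

variable {σ : ℤ}

/-- Every integer is uniquely `r + σ m` with `r` a standard residue modulo `|σ|`. -/
lemma bijective_residue_add_mul (hσ : σ ≠ 0) :
    Function.Bijective (fun p : ZMod σ.natAbs × ℤ => ((p.1.val : ℤ) + σ * p.2)) := by
  have : NeZero σ.natAbs := ⟨by simpa using hσ⟩
  have hc : ((σ : ℤ) : ZMod σ.natAbs) = 0 := by
    rw [ZMod.intCast_zmod_eq_zero_iff_dvd]; exact Int.natAbs_dvd.2 dvd_rfl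
  constructor
  · rintro ⟨r, m⟩ ⟨r', m'⟩ h
    have h' : (r.val : ℤ) + σ * m = r'.val + σ * m' := h
    have hr : r = r' := by
      have := congrArg (fun z : ℤ => (z : ZMod σ.natAbs)) h'
      simpa [hc] using this
    subst hr
    have : m = m' := mul_left_cancel₀ hσ (by linarith)
    rw [this]
  · intro α
    have : σ ∣ α - ((α : ZMod σ.natAbs).val : ℤ) := by
      rw [← Int.natAbs_dvd, ← ZMod.intCast_zmod_eq_zero_iff_dvd]
      simp
    obtain ⟨m, hm⟩ := this
    exact ⟨((α : ZMod σ.natAbs), m), by simp only; linarith⟩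

/-- Summation over `ℤ` by residue classes modulo `σ`. -/
lemma finsum_eq_sum_residues [NeZero σ.natAbs] (hσ : σ ≠ 0) {F : ℤ → ℝ}
    (hF : F.support.Finite) :
    ∑ᶠ α, F α = ∑ r : ZMod σ.natAbs, ∑ᶠ m : ℤ, F (r.val + σ * m) := by
  have hb := bijective_residue_add_mul hσ
  rw [← finsum_eq_of_bijective _ hb (fun _ => rfl), finsum_curry, finsum_eq_sum_of_fintype]
  exact Set.Finite.preimage hb.injective.injOn hF

lemma injective_add_mul (hσ : σ ≠ 0) (a : ℤ) : Function.Injective fun m : ℤ => a + σ * m :=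
  fun _ _ h => mul_left_cancel₀ hσ (add_left_cancel h)

/-- The Laurent polynomial `∑ₘ f(a + σ m) zᵐ`. -/
def polyphase (hσ : σ ≠ 0) (f : ℤ → ℝ) (hf : f.support.Finite) (a : ℤ) :
    AddMonoidAlgebra ℝ ℤ :=
  .ofCoeff (Finsupp.ofSupportFinite (fun m => f (a + σ * m))
    (Set.Finite.preimage (injective_add_mul hσ a).injOn hf))

lemma coeff_polyphase (hσ : σ ≠ 0) (f : ℤ → ℝ) (hf : f.support.Finite) (a m : ℤ) :
    (polyphase hσ f hf a).coeff m = f (a + σ * m) := rfl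

lemma coeff_mul_eq_finsum (p q : AddMonoidAlgebra ℝ ℤ) (n : ℤ) :
    (p * q).coeff n = ∑ᶠ m : ℤ, p.coeff m * q.coeff (n - m) := by
  rw [AddMonoidAlgebra.coeff_mul_apply_left, Finsupp.sum,
    finsum_eq_sum_of_support_subset (s := p.coeff.support)]
  · exact Finset.sum_congr rfl fun m _ => by rw [neg_add_eq_sub]
  · intro m hm
    simp only [Function.mem_support] at hm
    simpa using left_ne_zero_of_mul hm

lemma coeff_one_eq_ite (n : ℤ) :
    (1 : AddMonoidAlgebra ℝ ℤ).coeff n = if n = 0 then 1 else 0 := by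
  rw [AddMonoidAlgebra.one_def, AddMonoidAlgebra.coeff_single, Finsupp.single_apply]
  simp only [eq_comm]

/-- An orthonormal system of `|σ|` filters is complete: since the polyphase matrix is square,
its left inverse is also its right inverse. -/
theorem IsWaveletFilterSystem.reconstruction [NeZero σ.natAbs] (hσ : σ ≠ 0) {h : ℤ → ℝ}
    {g : ZMod σ.natAbs → ℤ → ℝ} (hg : IsWaveletFilterSystem σ h g) (α β : ℤ) :
    ∑ k, ∑ᶠ γ : ℤ, g k (α - σ * γ) * g k (β - σ * γ) = if α = β then |(σ : ℝ)| else 0 := by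
  classical
  let A : Matrix (ZMod σ.natAbs) (ZMod σ.natAbs) (AddMonoidAlgebra ℝ ℤ) :=
    fun k r => polyphase hσ (g k) (hg.finite_support k) r.val
  -- The sign change σ ↦ -σ replaces z by z⁻¹, so B is the adjoint of the polyphase matrix A and the
  -- coefficients of A * B are the correlations in the filter identity.
  let B : Matrix (ZMod σ.natAbs) (ZMod σ.natAbs) (AddMonoidAlgebra ℝ ℤ) :=
    fun r k => polyphase (neg_ne_zero.2 hσ) (g k) (hg.finite_support k) r.val
  let c : AddMonoidAlgebra ℝ ℤ := .single 0 |(σ : ℝ)|⁻¹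
  have hs : |(σ : ℝ)| ≠ 0 := by simpa using hσ
  have hcoeff : ∀ (c : ℝ) (x : AddMonoidAlgebra ℝ ℤ) (n : ℤ),
      (AddMonoidAlgebra.single 0 c * x).coeff n = c * x.coeff n := by
    intro c x n
    rw [AddMonoidAlgebra.coeff_single_mul_apply]; simp
  have hAB : (c • A) * B = 1 := by
    rw [Matrix.smul_mul]
    ext k l n
    rw [Matrix.smul_apply, smul_eq_mul, hcoeff, Matrix.mul_apply]
    have : (∑ r, A k r * B r l).coeff n = ∑ᶠ α : ℤ, g k α * g l (α - σ * n) := by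
      rw [finsum_eq_sum_residues hσ]
      · rw [AddMonoidAlgebra.coeff_sum, Finsupp.finsetSum_apply]
        refine Finset.sum_congr rfl fun r _ => ?_
        rw [coeff_mul_eq_finsum]
        refine finsum_congr fun m => ?_
        simp only [A, B, coeff_polyphase]
        congr 2; ring
      · exact (hg.finite_support k).subset fun m hm => left_ne_zero_of_mul hm
    rw [this, hg.qmf, Matrix.one_apply]
    by_cases hkl : k = l
    · rw [if_pos hkl, coeff_one_eq_ite]
      by_cases hn : n = 0
      · rw [if_pos ⟨hkl, hn⟩, if_pos hn, inv_mul_cancel₀ hs]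
      · rw [if_neg (fun h => hn h.2), if_neg hn, mul_zero]
    · rw [if_neg (fun h => hkl h.1), if_neg hkl, mul_zero, AddMonoidAlgebra.coeff_zero,
        Finsupp.zero_apply]
  have hBA := mul_eq_one_comm.1 hAB
  obtain ⟨⟨r, a⟩, rfl⟩ := (bijective_residue_add_mul hσ).surjective α
  obtain ⟨⟨r', b⟩, rfl⟩ := (bijective_residue_add_mul hσ).surjective β
  -- With α = r + σ a and β = r' + σ b, substituting γ = m + a turns the sum over γ into the
  -- coefficient of z^(b - a) in the entry (r, r') of B * A.
  have key := congrArg (fun M => (M r r').coeff (b - a)) hBA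
  simp only [Matrix.mul_smul, Matrix.smul_apply, smul_eq_mul, c, hcoeff] at key
  rw [Matrix.mul_apply, AddMonoidAlgebra.coeff_sum, Finsupp.finsetSum_apply] at key
  have : ∑ k, ∑ᶠ γ : ℤ, g k (r.val + σ * a - σ * γ) * g k (r'.val + σ * b - σ * γ)
      = ∑ k, (B r k * A k r').coeff (b - a) := by
    refine Finset.sum_congr rfl fun k _ => ?_
    rw [coeff_mul_eq_finsum]
    refine (finsum_eq_of_bijective (fun m => m + a) (Equiv.addRight a).bijective fun m => ?_).symm
    simp only [A, B, coeff_polyphase]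
    congr 2 <;> ring
  simp only at this ⊢
  refine mul_left_cancel₀ (inv_ne_zero hs) ?_
  rw [this, key]
  have hiff : ((r.val : ℤ) + σ * a = r'.val + σ * b) ↔ (r = r' ∧ a = b) := by
    rw [(bijective_residue_add_mul hσ).injective.eq_iff (a := (r, a)) (b := (r', b)),
      Prod.mk.injEq]
  simp only [hiff, Matrix.one_apply]
  by_cases hr : r = r'
  · rw [if_pos hr, coeff_one_eq_ite]
    by_cases hn : a = b
    · rw [if_pos (by rw [hn, sub_self]), if_pos ⟨hr, hn⟩, inv_mul_cancel₀ hs]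
    · rw [if_neg (sub_ne_zero.2 (Ne.symm hn)), if_neg (fun h => hn h.2), mul_zero]
  · rw [if_neg hr, if_neg (fun h => hr h.1), mul_zero, AddMonoidAlgebra.coeff_zero,
      Finsupp.zero_apply]

end Filters

/-! ### Closed spans and inner products in L₂. -/

section Spans

variable {E G K : Type*} [MeasureSpace E]

/-- A submodule of `L₂` containing the summands contains finite linear combinations. -/
lemma mem_of_ae_eq_sum {ι : Type*} (W : Submodule ℝ (Lp ℝ 2 (volume : Measure E)))
    {F : ι → E → ℝ} (hF : ∀ i, MemLp (F i) 2 (volume : Measure E))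
    (hW : ∀ i, ∀ f : Lp ℝ 2 (volume : Measure E), f =ᵐ[volume] F i → f ∈ W)
    (c : ι → ℝ) (t : Finset ι) (f : Lp ℝ 2 (volume : Measure E))
    (hf : f =ᵐ[volume] fun x => ∑ i ∈ t, c i * F i x) : f ∈ W := by
  classical
  induction t using Finset.induction_on generalizing f with
  | empty =>
    have : f = 0 := by
      rw [Lp.eq_zero_iff_ae_eq_zero]
      filter_upwards [hf] with x hx
      simpa using hx
    rw [this]; exact W.zero_mem
  | insert a t ha ih =>
    have h1 : f - c a • (hF a).toLp (F a) ∈ W := by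
      apply ih
      filter_upwards [hf, Lp.coeFn_sub f (c a • (hF a).toLp (F a)),
        Lp.coeFn_smul (c a) ((hF a).toLp (F a)), (hF a).coeFn_toLp] with x h1 h2 h3 h4
      rw [h2, Pi.sub_apply, h3, Pi.smul_apply, h4, h1, Finset.sum_insert ha, smul_eq_mul]
      ring
    have h2 := W.add_mem h1 (W.smul_mem (c a) (hW a _ (hF a).coeFn_toLp))
    simpa using h2

/-- Inner products in `L₂` computed on representatives. -/
lemma inner_eq_integral_of_ae_eq {u v : Lp ℝ 2 (volume : Measure E)} {F H : E → ℝ}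
    (hu : u =ᵐ[volume] F) (hv : v =ᵐ[volume] H) : inner ℝ u v = ∫ x, F x * H x := by
  rw [L2.inner_def]
  refine integral_congr_ae ?_
  filter_upwards [hu, hv] with x h1 h2
  rw [h1, h2, real_inner_eq_re_inner]
  simp [mul_comm]

variable [AddCommGroup E]

lemma mem_dilatedSpan {D : ℤ → E → E} {emb : G → E} {Φ : K → E → ℝ} {j : ℤ}
    {f : Lp ℝ 2 (volume : Measure E)} (k : K) (α : G)
    (hf : f =ᵐ[volume] fun x => Φ k (D j x - emb α)) : f ∈ dilatedSpan D emb Φ j :=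
  Submodule.le_topologicalClosure _ (Submodule.subset_span ⟨k, α, hf⟩)

lemma dilatedSpan_le {D : ℤ → E → E} {emb : G → E} {Φ : K → E → ℝ} {j : ℤ}
    {W : Submodule ℝ (Lp ℝ 2 (volume : Measure E))} (hW : IsClosed (W : Set (Lp ℝ 2 (volume : Measure E))))
    (h : ∀ (k : K) (α : G) (f : Lp ℝ 2 (volume : Measure E)),
      f =ᵐ[volume] (fun x => Φ k (D j x - emb α)) → f ∈ W) : dilatedSpan D emb Φ j ≤ W := by
  refine Submodule.topologicalClosure_minimal _ (Submodule.span_le.2 ?_) hW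
  rintro f ⟨k, α, hf⟩
  exact h k α f hf

lemma isClosed_dilatedSpan (D : ℤ → E → E) (emb : G → E) (Φ : K → E → ℝ) (j : ℤ) :
    IsClosed (dilatedSpan D emb Φ j : Set (Lp ℝ 2 (volume : Measure E))) :=
  Submodule.isClosed_topologicalClosure _

end Spans

/-! ### Affine changes of variable on the line. -/

section Affine

lemma map_volume_affine {c : ℝ} (hc : c ≠ 0) (a : ℝ) :
    Measure.map (fun x : ℝ => c * x - a) volume = ENNReal.ofReal |c⁻¹| • volume := by
  have h1 : (fun x : ℝ => c * x - a) = (fun y => y - a) ∘ (fun x => c * x) := rfl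
  rw [h1, ← Measure.map_map (by fun_prop) (by fun_prop), Real.map_volume_mul_left hc,
    Measure.map_smul, (measurePreserving_sub_right volume a).map_eq]

lemma quasiMeasurePreserving_affine {c : ℝ} (hc : c ≠ 0) (a : ℝ) :
    Measure.QuasiMeasurePreserving (fun x : ℝ => c * x - a) volume volume := by
  refine ⟨by fun_prop, ?_⟩
  rw [map_volume_affine hc]
  exact Measure.smul_absolutelyContinuous

lemma memLp_comp_affine {f : ℝ → ℝ} (hf : MemLp f 2 volume) {c : ℝ} (hc : c ≠ 0) (a : ℝ) :
    MemLp (fun x => f (c * x - a)) 2 volume := by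
  have h1 : MemLp f 2 (Measure.map (fun x : ℝ => c * x - a) volume) := by
    rw [map_volume_affine hc]
    exact hf.smul_measure ENNReal.ofReal_ne_top
  exact h1.comp_of_map (by fun_prop)

/-- Substitution y = c x - a. The case c = 0 is harmless: a constant has integral 0 over the line by
convention or by vanishing, and |0⁻¹| = 0. -/
lemma integral_comp_affine_mul (F H : ℝ → ℝ) (c a b : ℝ) :
    ∫ x, F (c * x - a) * H (c * x - b) = |c⁻¹| * ∫ y, F y * H (y - (b - a)) := by
  have h1 := Measure.integral_comp_mul_left (fun y => F (y - a) * H (y - b)) c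
  rw [h1, smul_eq_mul]
  congr 1
  rw [← integral_sub_right_eq_self (fun y => F y * H (y - (b - a))) a]
  refine integral_congr_ae (.of_forall fun x => ?_)
  simp only
  congr 2; ring

end Affine

/-! ### Univariate filtered functions and the splitting of V_{j+1}. -/

section Univariate

variable {σ : ℤ}

lemma dil_one (x : ℝ) : dil σ 1 x = σ * x := by simp [dil]

lemma filteredFunction_dil_eq_sum {b : ℤ → ℝ} {t : Finset ℤ} (ht : b.support ⊆ t)
    (φ : ℝ → ℝ) (x : ℝ) :
    filteredFunction (dil σ) (fun n : ℤ => (n : ℝ)) b φ x = ∑ α ∈ t, b α * φ (σ * x - α) := by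
  unfold filteredFunction
  rw [finsum_eq_sum_of_support_subset (s := t)]
  · simp [dil_one]
  · exact fun α hα => ht (left_ne_zero_of_mul hα)

lemma memLp_filteredFunction_dil (hσ : σ ≠ 0) {b : ℤ → ℝ} (hb : b.support.Finite) {φ : ℝ → ℝ}
    (hφ : MemLp φ 2 volume) :
    MemLp (filteredFunction (dil σ) (fun n : ℤ => (n : ℝ)) b φ) 2 volume := by
  have : filteredFunction (dil σ) (fun n : ℤ => (n : ℝ)) b φ
      = fun x => ∑ α ∈ hb.toFinset, b α * φ (σ * x - α) :=
    funext fun x => filteredFunction_dil_eq_sum (by simp) φ x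
  rw [this]
  exact memLp_finsetSum _ fun α _ =>
    (memLp_comp_affine hφ (Int.cast_ne_zero.2 hσ) _).const_mul _

lemma dil_ne_zero (hσ : σ ≠ 0) (j : ℤ) : ((σ : ℝ) ^ j) ≠ 0 :=
  zpow_ne_zero _ (Int.cast_ne_zero.2 hσ)

lemma dil_add_one (hσ : σ ≠ 0) (j : ℤ) (x : ℝ) : dil σ (j + 1) x = σ * dil σ j x := by
  unfold dil
  rw [zpow_add_one₀ (Int.cast_ne_zero.2 hσ)]; ring

/-- The translates of the filtered functions inherit the orthogonality of the filters. -/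
lemma integral_filteredFunction_mul (hσ : σ ≠ 0) {φ : ℝ → ℝ} (hφ : MemLp φ 2 volume)
    (ho : ∀ γ : ℤ, ∫ x, φ x * φ (x - γ) = if γ = 0 then 1 else 0) {a b : ℤ → ℝ}
    (ha : a.support.Finite) (hb : b.support.Finite) (γ : ℤ) :
    ∫ x, filteredFunction (dil σ) (fun n : ℤ => (n : ℝ)) a φ x *
      filteredFunction (dil σ) (fun n : ℤ => (n : ℝ)) b φ (x - γ)
      = |(σ : ℝ)|⁻¹ * ∑ᶠ α : ℤ, a α * b (α - σ * γ) := by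
  have hs : (σ : ℝ) ≠ 0 := Int.cast_ne_zero.2 hσ
  have hint : ∀ α β : ℤ, Integrable
      (fun x : ℝ => (a α * φ (σ * x - α)) * (b β * φ (σ * x - (σ * γ + β : ℤ)))) := fun α β =>
    ((memLp_comp_affine hφ hs α).const_mul (a α)).integrable_mul
      ((memLp_comp_affine hφ hs _).const_mul (b β))
  have h1 : ∀ x : ℝ, filteredFunction (dil σ) (fun n : ℤ => (n : ℝ)) a φ x *
      filteredFunction (dil σ) (fun n : ℤ => (n : ℝ)) b φ (x - γ)
      = ∑ α ∈ ha.toFinset, ∑ β ∈ hb.toFinset,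
        (a α * φ (σ * x - α)) * (b β * φ (σ * x - (σ * γ + β : ℤ))) := by
    intro x
    rw [filteredFunction_dil_eq_sum (t := ha.toFinset) (by simp),
      filteredFunction_dil_eq_sum (t := hb.toFinset) (by simp), Finset.sum_mul_sum]
    refine Finset.sum_congr rfl fun α _ => Finset.sum_congr rfl fun β _ => ?_
    congr 3; push_cast; ring
  simp_rw [h1]
  rw [integral_finsetSum _ fun α _ => integrable_finsetSum _ fun β _ => hint α β]
  simp_rw [integral_finsetSum _ fun β _ => hint _ β]
  rw [finsum_eq_sum_of_support_subset (fun α => a α * b (α - σ * γ)) (s := ha.toFinset)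
    (by intro α hα; simpa using left_ne_zero_of_mul hα), Finset.mul_sum]
  refine Finset.sum_congr rfl fun α _ => ?_
  -- Orthonormality of the translates of φ leaves only the term whose two shifts agree: σ γ + β = α.
  have h2 : ∀ β : ℤ, ∫ x : ℝ, (a α * φ (σ * x - α)) * (b β * φ (σ * x - (σ * γ + β : ℤ)))
      = if β = α - σ * γ then |(σ : ℝ)|⁻¹ * (a α * b β) else 0 := by
    intro β
    have : ∀ x : ℝ, (a α * φ (σ * x - α)) * (b β * φ (σ * x - (σ * γ + β : ℤ)))
      = (a α * b β) * (φ (σ * x - α) * φ (σ * x - (σ * γ + β : ℤ))) := fun x => by ring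
    simp_rw [this]
    rw [integral_const_mul, integral_comp_affine_mul, ← Int.cast_sub, ho, abs_inv]
    have : σ * γ + β - α = 0 ↔ β = α - σ * γ := by constructor <;> intro h <;> linarith
    simp only [this]
    split_ifs <;> ring
  simp_rw [h2]
  rw [Finset.sum_ite_eq']
  split_ifs with h
  · rfl
  · have : b (α - σ * γ) = 0 := by simpa using h
    rw [this]; ring

section System

variable {h : ℤ → ℝ} {g : ZMod σ.natAbs → ℤ → ℝ}

lemma integral_wavelet_mul (hg : IsWaveletFilterSystem σ h g)
    (hσ : σ ≠ 0) {φ : ℝ → ℝ} (hφ : MemLp φ 2 volume)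
    (ho : ∀ γ : ℤ, ∫ x, φ x * φ (x - γ) = if γ = 0 then 1 else 0)
    (k l : ZMod σ.natAbs) (γ : ℤ) :
    ∫ x, filteredFunction (dil σ) (fun n : ℤ => (n : ℝ)) (g k) φ x *
      filteredFunction (dil σ) (fun n : ℤ => (n : ℝ)) (g l) φ (x - γ)
      = if k = l ∧ γ = 0 then 1 else 0 := by
  have hs : |(σ : ℝ)| ≠ 0 := by simpa using hσ
  rw [integral_filteredFunction_mul hσ hφ ho (hg.finite_support k) (hg.finite_support l), hg.qmf]
  split_ifs
  · exact inv_mul_cancel₀ hs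
  · simp

/-- The translates at the finer level are linear combinations of those of the wavelets. -/
lemma exists_reconstruction (hg : IsWaveletFilterSystem σ h g)
    (hσ : σ ≠ 0) (φ : ℝ → ℝ) (β : ℤ) :
    ∃ t : Finset (ZMod σ.natAbs × ℤ), ∀ x : ℝ, φ (σ * x - β) =
      ∑ p ∈ t, (|(σ : ℝ)|⁻¹ * g p.1 (β - σ * p.2)) *
        filteredFunction (dil σ) (fun n : ℤ => (n : ℝ)) (g p.1) φ (x - p.2) := by
  classical
  have : NeZero σ.natAbs := ⟨by simpa using hσ⟩
  have hs : |(σ : ℝ)| ≠ 0 := by simpa using hσ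
  have hfin : ∀ k, {γ : ℤ | g k (β - σ * γ) ≠ 0}.Finite := fun k =>
    Set.Finite.preimage (f := fun γ : ℤ => β - σ * γ)
      (fun _ _ _ _ h => mul_left_cancel₀ hσ (sub_right_injective h)) (hg.finite_support k)
  let t : Finset ℤ := Finset.univ.biUnion fun k => (hfin k).toFinset
  have ht : ∀ k γ, g k (β - σ * γ) ≠ 0 → γ ∈ t := fun k γ hγ =>
    Finset.mem_biUnion.2 ⟨k, Finset.mem_univ _, by simpa using hγ⟩
  refine ⟨Finset.univ ×ˢ t, fun x => ?_⟩
  -- A common finite index set for the expansions of all the translates involved; β is added so that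
  -- the Kronecker delta produced by reconstruction is caught by the final sum.
  let R : Finset ℤ := insert β (Finset.univ.biUnion fun k => t.biUnion fun γ =>
    (hg.finite_support k).toFinset.image fun α => α + σ * γ)
  have hR : ∀ k, ∀ γ ∈ t, filteredFunction (dil σ) (fun n : ℤ => (n : ℝ)) (g k) φ (x - γ)
      = ∑ α ∈ R, g k (α - σ * γ) * φ (σ * x - α) := by
    intro k γ hγ
    rw [← finsum_eq_sum_of_support_subset]
    · unfold filteredFunction
      refine finsum_eq_of_bijective (fun α => α + σ * γ) (Equiv.addRight (σ * γ)).bijective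
        fun α => ?_
      simp only [dil_one]
      congr 2
      · ring
      · push_cast; ring
    · intro α hα
      have h1 : g k (α - σ * γ) ≠ 0 := left_ne_zero_of_mul hα
      refine Finset.mem_insert_of_mem (Finset.mem_biUnion.2 ⟨k, Finset.mem_univ _,
        Finset.mem_biUnion.2 ⟨γ, hγ, Finset.mem_image.2 ⟨α - σ * γ, by simpa using h1, by ring⟩⟩⟩)
  have hrec : ∀ α, ∑ k, ∑ γ ∈ t, g k (β - σ * γ) * g k (α - σ * γ)
      = if β = α then |(σ : ℝ)| else 0 := by
    intro α
    rw [← hg.reconstruction hσ]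
    refine Finset.sum_congr rfl fun k _ => ?_
    rw [finsum_eq_sum_of_support_subset]
    exact fun γ hγ => ht k γ (left_ne_zero_of_mul hγ)
  rw [Finset.sum_product]
  have h2 : ∀ k, ∀ γ ∈ t, (|(σ : ℝ)|⁻¹ * g k (β - σ * γ)) *
        filteredFunction (dil σ) (fun n : ℤ => (n : ℝ)) (g k) φ (x - γ)
      = ∑ α ∈ R, (|(σ : ℝ)|⁻¹ * φ (σ * x - α)) * (g k (β - σ * γ) * g k (α - σ * γ)) := by
    intro k γ hγ
    rw [hR k γ hγ, Finset.mul_sum]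
    exact Finset.sum_congr rfl fun α _ => by ring
  rw [Finset.sum_congr rfl fun k _ => Finset.sum_congr rfl (h2 k)]
  rw [Finset.sum_congr rfl fun k _ => Finset.sum_comm, Finset.sum_comm]
  simp_rw [← Finset.mul_sum, hrec]
  simp only [mul_ite, mul_zero]
  rw [Finset.sum_ite_eq, if_pos (Finset.mem_insert_self _ _)]
  field_simp

/-- The scaling space at level `j + 1` is spanned by all the wavelets at level `j`, the scaling
function included. -/
theorem dilatedSpan_filteredFunction_eq (hg : IsWaveletFilterSystem σ h g)
    (hσ : σ ≠ 0) {φ : ℝ → ℝ} (hφ : MemLp φ 2 volume)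
    (j : ℤ) :
    dilatedSpan (dil σ) (fun n : ℤ => (n : ℝ))
      (fun k => filteredFunction (dil σ) (fun n : ℤ => (n : ℝ)) (g k) φ) j
      = scalingSpace (dil σ) (fun n : ℤ => (n : ℝ)) φ (j + 1) := by
  apply le_antisymm
  · refine dilatedSpan_le (isClosed_dilatedSpan _ _ _ _) fun k α f hf => ?_
    refine mem_of_ae_eq_sum (dilatedSpan (dil σ) (fun n : ℤ => (n : ℝ)) (fun _ : Unit => φ) (j + 1))
      (F := fun (β : ℤ) x => φ (dil σ (j + 1) x - (σ * α + β : ℤ)))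
      (fun β => memLp_comp_affine hφ (dil_ne_zero hσ _) _)
      (fun β f hf => mem_dilatedSpan () (σ * α + β) hf) (g k) (hg.finite_support k).toFinset f ?_
    filter_upwards [hf] with x hx
    rw [hx, filteredFunction_dil_eq_sum (t := (hg.finite_support k).toFinset) (by simp)]
    refine Finset.sum_congr rfl fun β _ => ?_
    rw [dil_add_one hσ]
    congr 2; push_cast; ring
  · refine dilatedSpan_le (isClosed_dilatedSpan _ _ _ _) fun _ β f hf => ?_
    obtain ⟨t, ht⟩ := exists_reconstruction hg hσ φ β
    refine mem_of_ae_eq_sum _ (F := fun (p : ZMod σ.natAbs × ℤ) x =>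
        filteredFunction (dil σ) (fun n : ℤ => (n : ℝ)) (g p.1) φ (dil σ j x - p.2))
      (fun p => memLp_comp_affine (memLp_filteredFunction_dil hσ (hg.finite_support p.1) hφ)
        (dil_ne_zero hσ _) _)
      (fun p f hf => mem_dilatedSpan p.1 p.2 hf)
      (fun p => |(σ : ℝ)|⁻¹ * g p.1 (β - σ * p.2)) t f ?_
    filter_upwards [hf] with x hx
    rw [hx, dil_add_one hσ, ht]

end System

end Univariate

/-- A continuous multilinear map with values in a closed submodule on a product of sets has
values there on the product of the closed spans. -/
lemma ContinuousMultilinearMap.mem_of_forall_mem_closure_span {ι : Type*} [Fintype ι]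
    {M : ι → Type*} {N : Type*} [∀ i, NormedAddCommGroup (M i)] [∀ i, NormedSpace ℝ (M i)]
    [NormedAddCommGroup N] [NormedSpace ℝ N] (T : ContinuousMultilinearMap ℝ M N)
    {S : ∀ i, Set (M i)} {W : Submodule ℝ N} (hW : IsClosed (W : Set N))
    (hS : ∀ m : ∀ i, M i, (∀ i, m i ∈ S i) → T m ∈ W) {m : ∀ i, M i}
    (hm : ∀ i, m i ∈ (Submodule.span ℝ (S i)).topologicalClosure) : T m ∈ W := by
  classical
  -- Induction on the set of coordinates already enlarged from S i to its closed span.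
  have key : ∀ t : Finset ι, ∀ m : ∀ i, M i,
      (∀ i ∈ t, m i ∈ (Submodule.span ℝ (S i)).topologicalClosure) →
      (∀ i ∉ t, m i ∈ S i) → T m ∈ W := by
    intro t
    induction t using Finset.induction_on with
    | empty => exact fun m _ h2 => hS m fun i => h2 i (Finset.notMem_empty i)
    | insert a t ha ih =>
      intro m h1 h2
      -- With the other arguments fixed, the admissible values of the argument at a form a closed
      -- submodule containing S a.
      have hle : (Submodule.span ℝ (S a)).topologicalClosure ≤
          W.comap (T.toContinuousLinearMap m a : M a →ₗ[ℝ] N) := by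
        refine Submodule.topologicalClosure_minimal _ (Submodule.span_le.2 fun x hx => ?_)
          (hW.preimage (T.toContinuousLinearMap m a).continuous)
        refine ih (Function.update m a x) (fun i hi => ?_) (fun i hi => ?_)
        · have : i ≠ a := fun h => ha (h ▸ hi)
          rw [Function.update_of_ne this]
          exact h1 i (Finset.mem_insert_of_mem hi)
        · by_cases hia : i = a
          · subst hia; simpa using hx
          · rw [Function.update_of_ne hia]
            exact h2 i (by simp [hia, hi])
      have := hle (h1 a (Finset.mem_insert_self _ _))
      simpa [ContinuousMultilinearMap.toContinuousLinearMap] using this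
  exact key Finset.univ m (fun i _ => hm i) (fun i hi => absurd (Finset.mem_univ i) hi)

/-! ### Tensor products of L₂ functions and their totality. -/

section Tensor

variable {s : ℕ} {L : (Fin s → ℝ) ≃ᵐ (Fin s → ℝ)}

lemma integral_tensorFunction_comp (hL : MeasurePreserving L volume volume)
    (f : Fin s → ℝ → ℝ) : ∫ x, tensorFunction f (L x) = ∏ i, ∫ y, f i y := by
  rw [hL.integral_comp L.measurableEmbedding]
  exact integral_fintype_prod_volume_eq_prod f

lemma tensorFunction_comp_congr_ae (hL : MeasurePreserving L volume volume)
    {f f' : Fin s → ℝ → ℝ} (h : ∀ i, f i =ᵐ[volume] f' i) :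
    (fun x => tensorFunction f (L x)) =ᵐ[volume] fun x => tensorFunction f' (L x) := by
  have : ∀ᵐ y : Fin s → ℝ, tensorFunction f y = tensorFunction f' y := by
    have h1 : ∀ᵐ y : Fin s → ℝ, ∀ i, f i (y i) = f' i (y i) :=
      ae_all_iff.2 fun i => (Measure.quasiMeasurePreserving_eval
        (fun _ : Fin s => (volume : Measure ℝ)) i).ae (p := fun x => f i x = f' i x) (h i)
    filter_upwards [h1] with y hy
    exact Finset.prod_congr rfl fun i _ => hy i
  exact hL.quasiMeasurePreserving.ae this

lemma memLp_tensorFunction_comp (hL : MeasurePreserving L volume volume)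
    {f : Fin s → ℝ → ℝ} (hf : ∀ i, MemLp (f i) 2 volume) :
    MemLp (fun x => tensorFunction f (L x)) 2 volume := by
  have h1 : AEStronglyMeasurable (tensorFunction f) volume := by
    refine Finset.aestronglyMeasurable_fun_prod _ fun i _ => ?_
    exact (hf i).1.comp_quasiMeasurePreserving (Measure.quasiMeasurePreserving_eval _ i)
  have h2 : MemLp (tensorFunction f) 2 volume := by
    rw [memLp_two_iff_integrable_sq h1]
    have := Integrable.fintype_prod (f := fun i x => f i x ^ 2)
      (μ := fun _ : Fin s => (volume : Measure ℝ)) fun i => (hf i).integrable_sq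
    refine this.congr (.of_forall fun x => ?_)
    simp [tensorFunction, Finset.prod_pow]
  exact h2.comp_measurePreserving hL

lemma tensorFunction_update [DecidableEq (Fin s)] (u : Fin s → Lp ℝ 2 (volume : Measure ℝ))
    (i : Fin s) (v : Lp ℝ 2 (volume : Measure ℝ)) (y : Fin s → ℝ) :
    tensorFunction (fun j => (Function.update u i v j : ℝ → ℝ)) y
      = v (y i) * ∏ j ∈ Finset.univ.erase i, u j (y j) := by
  unfold tensorFunction
  rw [← Finset.mul_prod_erase _ _ (Finset.mem_univ i)]
  simp only [Function.update_self]
  congr 1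
  refine Finset.prod_congr rfl fun j hj => ?_
  rw [Function.update_of_ne (Finset.ne_of_mem_erase hj)]

lemma inner_eq_prod_of_ae_eq_tensorFunction (hL : MeasurePreserving L volume volume)
    {f f' : Lp ℝ 2 (volume : Measure (Fin s → ℝ))} {u v : Fin s → Lp ℝ 2 (volume : Measure ℝ)}
    (hf : f =ᵐ[volume] fun x => tensorFunction (fun i => u i) (L x))
    (hf' : f' =ᵐ[volume] fun x => tensorFunction (fun i => v i) (L x)) :
    inner ℝ f f' = ∏ i, inner ℝ (u i) (v i) := by
  rw [inner_eq_integral_of_ae_eq hf hf']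
  simp_rw [inner_eq_integral_of_ae_eq (Filter.EventuallyEq.refl _ (u _ : ℝ → ℝ))
    (Filter.EventuallyEq.refl _ (v _ : ℝ → ℝ))]
  rw [← integral_tensorFunction_comp hL]
  simp [tensorFunction, Finset.prod_mul_distrib]

/-- The tensor product `u ↦ ∏ᵢ uᵢ((L x)ᵢ)` of univariate `L₂` functions, in coordinates `L`. -/
def tensorLp (hL : MeasurePreserving L volume volume) :
    ContinuousMultilinearMap ℝ (fun _ : Fin s => Lp ℝ 2 (volume : Measure ℝ))
      (Lp ℝ 2 (volume : Measure (Fin s → ℝ))) :=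
  MultilinearMap.mkContinuous
    { toFun := fun u => (memLp_tensorFunction_comp hL fun i => Lp.memLp (u i)).toLp _
      map_update_add' := by
        intro _ u i v w
        rw [← MemLp.toLp_add]
        refine MemLp.toLp_congr _ _ ?_
        have h1 : ∀ᵐ y : ℝ, (v + w : Lp ℝ 2 volume) y = v y + w y := Lp.coeFn_add v w
        have h2 := hL.quasiMeasurePreserving.ae ((Measure.quasiMeasurePreserving_eval _ i).ae h1)
        filter_upwards [h2] with x hx
        rw [Pi.add_apply, tensorFunction_update, tensorFunction_update, tensorFunction_update]
        simp only [Function.eval] at hx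
        rw [hx, add_mul]
      map_update_smul' := by
        intro _ u i c v
        rw [← MemLp.toLp_const_smul]
        refine MemLp.toLp_congr _ _ ?_
        have h1 : ∀ᵐ y : ℝ, (c • v : Lp ℝ 2 volume) y = c • v y := Lp.coeFn_smul c v
        have h2 := hL.quasiMeasurePreserving.ae ((Measure.quasiMeasurePreserving_eval _ i).ae h1)
        filter_upwards [h2] with x hx
        rw [Pi.smul_apply, tensorFunction_update, tensorFunction_update]
        simp only [Function.eval] at hx
        rw [hx, smul_mul_assoc] } 1 (by
    intro u
    -- The norm of a pure tensor equals the product of the norms, which gives the bound with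
    -- constant 1.
    have h := inner_eq_prod_of_ae_eq_tensorFunction hL
      (memLp_tensorFunction_comp hL fun i => Lp.memLp (u i)).coeFn_toLp
      (memLp_tensorFunction_comp hL fun i => Lp.memLp (u i)).coeFn_toLp
    simp only [real_inner_self_eq_norm_sq, Finset.prod_pow] at h
    rw [one_mul]
    exact ((sq_eq_sq₀ (norm_nonneg _) (Finset.prod_nonneg fun _ _ => norm_nonneg _)).1 h).le)

lemma coeFn_tensorLp (hL : MeasurePreserving L volume volume)
    (u : Fin s → Lp ℝ 2 (volume : Measure ℝ)) :
    tensorLp hL u =ᵐ[volume] fun x => tensorFunction (fun i => u i) (L x) :=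
  (memLp_tensorFunction_comp hL fun i => Lp.memLp (u i)).coeFn_toLp

lemma tensorLp_eq_of_ae_eq (hL : MeasurePreserving L volume volume)
    {u : Fin s → Lp ℝ 2 (volume : Measure ℝ)} {F : Fin s → ℝ → ℝ}
    (hu : ∀ i, u i =ᵐ[volume] F i) :
    tensorLp hL u =ᵐ[volume] fun x => tensorFunction F (L x) :=
  (coeFn_tensorLp hL u).trans (tensorFunction_comp_congr_ae hL hu)

lemma inner_tensorLp (hL : MeasurePreserving L volume volume)
    (u v : Fin s → Lp ℝ 2 (volume : Measure ℝ)) :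
    inner ℝ (tensorLp hL u) (tensorLp hL v) = ∏ i, inner ℝ (u i) (v i) :=
  inner_eq_prod_of_ae_eq_tensorFunction hL (coeFn_tensorLp hL u) (coeFn_tensorLp hL v)

/-- The tensor products are total in `L₂`. -/
theorem eq_zero_of_inner_tensorLp_eq_zero (hL : MeasurePreserving L volume volume)
    {f : Lp ℝ 2 (volume : Measure (Fin s → ℝ))} (hf : ∀ u, inner ℝ (tensorLp hL u) f = 0) :
    f = 0 := by
  have hLs : MeasurePreserving L.symm volume volume := hL.symm
  let F : (Fin s → ℝ) → ℝ := fun y => f (L.symm y)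
  have hF : MemLp F 2 volume := (Lp.memLp f).comp_measurePreserving hLs
  -- F is only square integrable; on the bounded cubes B n it is integrable, so its set integrals
  -- can be used.
  let B : ℕ → Set (Fin s → ℝ) := fun n => Set.univ.pi fun _ => Set.Icc (-n : ℝ) n
  have hBm : ∀ n, MeasurableSet (B n) := fun n => .univ_pi fun _ => measurableSet_Icc
  have hBfin : ∀ n, volume (B n) ≠ ⊤ := fun n =>
    (isCompact_univ_pi fun _ => isCompact_Icc).measure_lt_top.ne
  have hint : ∀ n, IntegrableOn F (B n) := by
    intro n
    have : IsFiniteMeasure (volume.restrict (B n)) := ⟨by simpa using (hBfin n).lt_top⟩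
    exact (hF.restrict (B n)).integrable (by norm_num)
  -- The indicator of a box is itself a tensor product, so the hypothesis gives zero integral on it.
  have hbox : ∀ n (S : Fin s → Set ℝ), (∀ i, MeasurableSet (S i)) →
      ∫ y in Set.univ.pi S, F y ∂(volume.restrict (B n)) = 0 := by
    intro n S hS
    let I : Fin s → Set ℝ := fun i => S i ∩ Set.Icc (-n : ℝ) n
    have hI : ∀ i, MeasurableSet (I i) := fun i => (hS i).inter measurableSet_Icc
    have hIf : ∀ i, volume (I i) ≠ ⊤ := fun i =>
      ((measure_mono Set.inter_subset_right).trans_lt measure_Icc_lt_top).ne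
    have h1 := hf fun i => indicatorConstLp 2 (hI i) (hIf i) (1 : ℝ)
    rw [inner_eq_integral_of_ae_eq
      (tensorLp_eq_of_ae_eq hL fun i => indicatorConstLp_coeFn) (Filter.EventuallyEq.refl _ _)] at h1
    have h2 : ∀ x, f x = F (L x) := fun x => by simp [F]
    simp_rw [h2] at h1
    rw [hL.integral_comp L.measurableEmbedding
      (fun y => tensorFunction (fun i => (I i).indicator fun _ => (1 : ℝ)) y * F y)] at h1
    rw [Measure.restrict_restrict (.univ_pi hS), ← Set.pi_inter_distrib,
      ← integral_indicator (.univ_pi hI), ← h1]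
    congr 1
    ext y
    by_cases hy : y ∈ Set.univ.pi I
    · rw [Set.indicator_of_mem hy]
      have : tensorFunction (fun i => (I i).indicator fun _ => (1 : ℝ)) y = 1 :=
        Finset.prod_eq_one fun i _ => Set.indicator_of_mem (hy i trivial) _
      rw [this, one_mul]
    · rw [Set.indicator_of_notMem hy]
      simp only [Set.mem_pi, Set.mem_univ, true_imp_iff, not_forall] at hy
      obtain ⟨i, hi⟩ := hy
      have : tensorFunction (fun i => (I i).indicator fun _ => (1 : ℝ)) y = 0 :=
        Finset.prod_eq_zero (Finset.mem_univ i) (Set.indicator_of_notMem hi _)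
      rw [this, zero_mul]
  -- Boxes form a π-system generating the Borel sets, so vanishing extends to all measurable sets.
  have hall : ∀ n (A : Set (Fin s → ℝ)), MeasurableSet A →
      ∫ y in A, F y ∂(volume.restrict (B n)) = 0 := by
    intro n A hA
    have huniv : ∫ y, F y ∂(volume.restrict (B n)) = 0 := by
      simpa using hbox n (fun _ => Set.univ) fun _ => .univ
    refine MeasurableSpace.induction_on_inter
      (C := fun A _ => ∫ y in A, F y ∂(volume.restrict (B n)) = 0)
      (generateFrom_pi (α := fun _ : Fin s => ℝ)).symm isPiSystem_pi (by simp) ?_ ?_ ?_ A hA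
    · rintro _ ⟨S, hS, rfl⟩
      exact hbox n S fun i => hS i trivial
    · intro t ht ih
      have := integral_add_compl ht (hint n)
      rw [ih, huniv, zero_add] at this
      exact this
    · intro A hd hA ih
      rw [integral_iUnion hA hd (hint n).integrableOn]
      simp [ih]
  have hzero : ∀ n, ∀ᵐ y, y ∈ B n → F y = 0 := by
    intro n
    have := (hint n).ae_eq_zero_of_forall_setIntegral_eq_zero fun A hA _ => hall n A hA
    exact (ae_restrict_iff' (hBm n)).1 this
  have hF0 : ∀ᵐ y, F y = 0 := by
    filter_upwards [ae_all_iff.2 hzero] with y hy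
    obtain ⟨n, hn⟩ := exists_nat_ge ‖y‖
    refine hy n fun i _ => ?_
    have := (norm_le_pi_norm y i).trans hn
    rw [Real.norm_eq_abs, abs_le] at this
    exact this
  rw [Lp.eq_zero_iff_ae_eq_zero]
  filter_upwards [hL.quasiMeasurePreserving.ae hF0] with x hx
  simpa [F] using hx

end Tensor

/-! ### Tensor product multiresolution analyses -/

/-- Two orthogonal subspaces spanning `V'` up to closure are complementary in `V'`. -/
lemma eq_inf_orthogonal_of_le_closure_sup {H : Type*} [NormedAddCommGroup H]
    [InnerProductSpace ℝ H] [CompleteSpace H] {V V' W : Submodule ℝ H}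
    (hWc : IsClosed (W : Set H)) (hWV' : W ≤ V') (hWV : W ≤ Vᗮ)
    (hV' : V' ≤ (V ⊔ W).topologicalClosure) : W = V' ⊓ Vᗮ := by
  refine le_antisymm (le_inf hWV' hWV) ?_
  rintro f ⟨hf1, hf2⟩
  have : CompleteSpace W := hWc.completeSpace_coe
  obtain ⟨p, hp, q, hq, rfl⟩ := W.exists_add_mem_mem_orthogonal f
  have hqV' : q ∈ V' := by simpa using V'.sub_mem hf1 (hWV' hp)
  have hqV : q ∈ Vᗮ := by simpa using Vᗮ.sub_mem hf2 (hWV hp)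
  -- The remainder q is orthogonal to V ⊔ W and also lies in its closure, so it is zero.
  have h1 : q ∈ (V ⊔ W)ᗮ := by
    rw [← Submodule.inf_orthogonal]; exact ⟨hqV, hq⟩
  rw [← Submodule.orthogonal_closure] at h1
  have h2 : inner ℝ q q = 0 := h1 q (hV' hqV')
  rw [inner_self_eq_zero.1 h2, add_zero]
  exact hp

section TensorMRA

variable {s : ℕ} {σ : Fin s → ℤ} {L : (Fin s → ℝ) ≃ᵐ (Fin s → ℝ)}
  {ℓ : (Fin s → ℤ) ≃+ (Fin s → ℤ)} {D : ℤ → (Fin s → ℝ) → Fin s → ℝ}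

/-- In the coordinates `L`, the dilation `D` acts as `σ i` on the `i`-th coordinate, and the
lattice is preserved, `L` acting on it as `ℓ`. -/
structure DiagonalCoordinates (σ : Fin s → ℤ) (L : (Fin s → ℝ) ≃ᵐ (Fin s → ℝ))
    (ℓ : (Fin s → ℤ) ≃+ (Fin s → ℤ)) (D : ℤ → (Fin s → ℝ) → Fin s → ℝ) : Prop where
  measurePreserving : MeasurePreserving L volume volume
  ne_zero : ∀ i, σ i ≠ 0
  apply_sub : ∀ x α i, L (x - latticeEmb α) i = L x i - (ℓ α i : ℝ)
  apply_dil : ∀ j x i, L (D j x) i = dil (σ i) j (L x i)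

namespace DiagonalCoordinates

lemma tensorFunction_dil (hD : DiagonalCoordinates σ L ℓ D) (F : Fin s → ℝ → ℝ) (j : ℤ)
    (x : Fin s → ℝ) (α : Fin s → ℤ) :
    tensorFunction F (L (D j x - latticeEmb α))
      = tensorFunction (fun i y => F i (dil (σ i) j y - (ℓ α i : ℝ))) (L x) :=
  Finset.prod_congr rfl fun i _ => by rw [hD.apply_sub, hD.apply_dil]

lemma tensorFunction_sub (hD : DiagonalCoordinates σ L ℓ D) (F : Fin s → ℝ → ℝ)
    (x : Fin s → ℝ) (α : Fin s → ℤ) :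
    tensorFunction F (L (x - latticeEmb α))
      = tensorFunction (fun i y => F i (y - (ℓ α i : ℝ))) (L x) :=
  Finset.prod_congr rfl fun i _ => by rw [hD.apply_sub]

lemma integral_tensorFunction_mul (hD : DiagonalCoordinates σ L ℓ D) (F H : Fin s → ℝ → ℝ) :
    ∫ x, tensorFunction F (L x) * tensorFunction H (L x) = ∏ i, ∫ y, F i y * H i y := by
  rw [← integral_tensorFunction_comp hD.measurePreserving]
  simp [tensorFunction, Finset.prod_mul_distrib]

variable {K : Fin s → Type*} {Φ : ∀ i, K i → ℝ → ℝ} {P : (∀ i, K i) → Prop}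

lemma tensorLp_mem_dilatedSpan (hD : DiagonalCoordinates σ L ℓ D) {j : ℤ} (η : Subtype P)
    (β : Fin s → ℤ) {u : Fin s → Lp ℝ 2 (volume : Measure ℝ)}
    (hu : ∀ i, u i =ᵐ[volume] fun y => Φ i (η.1 i) (dil (σ i) j y - (β i : ℝ))) :
    tensorLp hD.measurePreserving u ∈ dilatedSpan D latticeEmb
      (fun (η : Subtype P) x => tensorFunction (fun i => Φ i (η.1 i)) (L x)) j := by
  refine mem_dilatedSpan η (ℓ.symm β) ?_
  filter_upwards [tensorLp_eq_of_ae_eq hD.measurePreserving hu] with x hx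
  rw [hx, hD.tensorFunction_dil, AddEquiv.apply_symm_apply]

lemma exists_eq_tensorLp (hD : DiagonalCoordinates σ L ℓ D) {F : Fin s → ℝ → ℝ}
    (hF : ∀ i, MemLp (F i) 2 volume) {j : ℤ} {α : Fin s → ℤ}
    {f : Lp ℝ 2 (volume : Measure (Fin s → ℝ))}
    (hf : f =ᵐ[volume] fun x => tensorFunction F (L (D j x - latticeEmb α))) :
    ∃ u : Fin s → Lp ℝ 2 (volume : Measure ℝ),
      (∀ i, u i =ᵐ[volume] fun y => F i (dil (σ i) j y - (ℓ α i : ℝ))) ∧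
      f = tensorLp hD.measurePreserving u := by
  have hm : ∀ i, MemLp (fun y => F i (dil (σ i) j y - (ℓ α i : ℝ))) 2 volume := fun i =>
    memLp_comp_affine (hF i) (dil_ne_zero (hD.ne_zero i) j) _
  refine ⟨fun i => (hm i).toLp _, fun i => (hm i).coeFn_toLp, Lp.ext ?_⟩
  filter_upwards [hf, tensorLp_eq_of_ae_eq hD.measurePreserving fun i => (hm i).coeFn_toLp]
    with x h1 h2
  rw [h1, h2, hD.tensorFunction_dil]

variable {φ : Fin s → ℝ → ℝ}

/-- On generators it is the bijectivity of the lattice map `ℓ`; multilinearity and continuity extend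
it to closed spans. -/
lemma tensorLp_mem_scalingSpace (hD : DiagonalCoordinates σ L ℓ D) {j : ℤ}
    {u : Fin s → Lp ℝ 2 (volume : Measure ℝ)}
    (hu : ∀ i, u i ∈ scalingSpace (dil (σ i)) (fun n : ℤ => (n : ℝ)) (φ i) j) :
    tensorLp hD.measurePreserving u
      ∈ scalingSpace D latticeEmb (fun x => tensorFunction φ (L x)) j := by
  refine ContinuousMultilinearMap.mem_of_forall_mem_closure_span _
    (isClosed_dilatedSpan _ _ _ _) (fun m hm => ?_) hu
  choose _ β hβ using hm
  refine mem_dilatedSpan () (ℓ.symm β) ?_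
  filter_upwards [tensorLp_eq_of_ae_eq hD.measurePreserving hβ] with x hx
  rw [hx, hD.tensorFunction_dil, AddEquiv.apply_symm_apply]

/-- Generators of the multivariate space are pure tensors, so inclusions and orthogonality relations
need testing only on these. -/
lemma scalingSpace_le (hD : DiagonalCoordinates σ L ℓ D) (hφ : ∀ i, MemLp (φ i) 2 volume)
    {j : ℤ} {W : Submodule ℝ (Lp ℝ 2 (volume : Measure (Fin s → ℝ)))}
    (hW : IsClosed (W : Set (Lp ℝ 2 (volume : Measure (Fin s → ℝ)))))
    (h : ∀ u : Fin s → Lp ℝ 2 (volume : Measure ℝ),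
      (∀ i, u i ∈ scalingSpace (dil (σ i)) (fun n : ℤ => (n : ℝ)) (φ i) j) →
      tensorLp hD.measurePreserving u ∈ W) :
    scalingSpace D latticeEmb (fun x => tensorFunction φ (L x)) j ≤ W := by
  refine dilatedSpan_le hW fun _ α f hf => ?_
  obtain ⟨u, hu, rfl⟩ := hD.exists_eq_tensorLp hφ hf
  exact h u fun i => mem_dilatedSpan () (ℓ α i) (hu i)

lemma prod_ite_and_eq_ite (m : Fin s → ℤ) (p : Fin s → Prop) [DecidablePred p] (q : Prop)
    [Decidable q] (hpq : q ↔ ∀ i, p i) :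
    ∏ i, (if p i ∧ m i = 0 then (1 : ℝ) else 0) = if q ∧ m = 0 then 1 else 0 := by
  have h : (q ∧ m = 0) ↔ ∀ i, p i ∧ m i = 0 := by rw [hpq, funext_iff, forall_and]; rfl
  by_cases hq : q ∧ m = 0
  · rw [if_pos hq]
    exact Finset.prod_eq_one fun i _ => if_pos (h.1 hq i)
  · rw [if_neg hq]
    rw [h, not_forall] at hq
    obtain ⟨i, hi⟩ := hq
    exact Finset.prod_eq_zero (Finset.mem_univ i) (if_neg hi)

/-- Tensor products of univariate orthogonal multiresolution analyses. -/
theorem isOrthogonalMRA (hD : DiagonalCoordinates σ L ℓ D) (hs : 0 < s)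
    (hφ : ∀ i, IsOrthogonalMRA (dil (σ i)) (fun n : ℤ => (n : ℝ)) (φ i)) :
    IsOrthogonalMRA D latticeEmb (fun x => tensorFunction φ (L x)) where
  memLp := memLp_tensorFunction_comp hD.measurePreserving fun i => (hφ i).memLp
  orthonormal γ := by
    simp_rw [hD.tensorFunction_sub]
    rw [hD.integral_tensorFunction_mul]
    simp_rw [(hφ _).orthonormal]
    have := prod_ite_and_eq_ite (ℓ γ) (fun _ => True) True (by simp)
    simpa using this
  nested j := hD.scalingSpace_le (fun i => (hφ i).memLp) (isClosed_dilatedSpan _ _ _ _)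
    fun u hu => hD.tensorLp_mem_scalingSpace fun i => (hφ i).nested j (hu i)
  dense := by
    rw [Submodule.topologicalClosure_eq_top_iff, Submodule.eq_bot_iff]
    intro f hf
    refine eq_zero_of_inner_tensorLp_eq_zero hD.measurePreserving fun u => ?_
    rw [← Submodule.orthogonal_closure] at hf
    refine hf _ ?_
    -- The factors may lie at different levels; as there are finitely many, nestedness moves them to
    -- a common level J.
    refine ContinuousMultilinearMap.mem_of_forall_mem_closure_span
      (S := fun i => ⋃ j, (scalingSpace (dil (σ i)) (fun n : ℤ => (n : ℝ)) (φ i) j :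
        Set (Lp ℝ 2 (volume : Measure ℝ)))) _ (Submodule.isClosed_topologicalClosure _)
      (fun m hm => ?_) fun i => ?_
    · simp only [Set.mem_iUnion] at hm
      choose j hj using hm
      obtain ⟨J, hJ⟩ := Finite.exists_le j
      refine Submodule.le_topologicalClosure _ (Submodule.mem_iSup_of_mem J ?_)
      exact hD.tensorLp_mem_scalingSpace fun i =>
        monotone_int_of_le_succ (hφ i).nested (hJ i) (hj i)
    · rw [← Submodule.iSup_eq_span, (hφ i).dense]
      trivial
  separated := by
    rw [Submodule.eq_bot_iff]
    intro f hf
    refine eq_zero_of_inner_tensorLp_eq_zero hD.measurePreserving fun u => ?_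
    let i₀ : Fin s := ⟨0, hs⟩
    -- All factors but the one at i₀ are frozen (s > 0 supplies i₀). The adjoint of A sends a pure
    -- tensor v to a multiple of v i₀, hence each V_j into the univariate V_j; so it sends f into
    -- their intersection, which is zero.
    let A := (tensorLp hD.measurePreserving).toContinuousLinearMap u i₀
    have hA : ∀ w, A w = tensorLp hD.measurePreserving (Function.update u i₀ w) := fun _ => rfl
    have hadj : ∀ v, ContinuousLinearMap.adjoint A (tensorLp hD.measurePreserving v)
        = (∏ i ∈ Finset.univ.erase i₀, inner ℝ (u i) (v i)) • v i₀ := by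
      intro v
      refine ext_inner_left ℝ fun w => ?_
      rw [ContinuousLinearMap.adjoint_inner_right, hA, inner_tensorLp, inner_smul_right,
        ← Finset.mul_prod_erase _ _ (Finset.mem_univ i₀), Function.update_self, mul_comm]
      congr 1
      refine Finset.prod_congr rfl fun i hi => ?_
      rw [Function.update_of_ne (Finset.ne_of_mem_erase hi)]
    have hmem : ContinuousLinearMap.adjoint A f ∈
        ⨅ j, scalingSpace (dil (σ i₀)) (fun n : ℤ => (n : ℝ)) (φ i₀) j := by
      rw [Submodule.mem_iInf] at hf ⊢
      intro j
      have hle : scalingSpace D latticeEmb (fun x => tensorFunction φ (L x)) j ≤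
          (scalingSpace (dil (σ i₀)) (fun n : ℤ => (n : ℝ)) (φ i₀) j).comap
            (ContinuousLinearMap.adjoint A : _ →ₗ[ℝ] _) := by
        refine hD.scalingSpace_le (fun i => (hφ i).memLp)
          ((isClosed_dilatedSpan _ _ _ _).preimage (ContinuousLinearMap.adjoint A).continuous)
          fun v hv => ?_
        rw [Submodule.mem_comap, ContinuousLinearMap.coe_coe, hadj]
        exact Submodule.smul_mem _ _ (hv i₀)
      exact hle (hf j)
    rw [(hφ i₀).separated, Submodule.mem_bot] at hmem
    have : tensorLp hD.measurePreserving u = A (u i₀) := by rw [hA, Function.update_eq_self]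
    rw [this, ← ContinuousLinearMap.adjoint_inner_right, hmem, inner_zero_right]

variable {g : ∀ i, ZMod (σ i).natAbs → ℤ → ℝ} {h : Fin s → ℤ → ℝ}

/-- The tensor product wavelets. -/
theorem isOrthonormalWavelets (hD : DiagonalCoordinates σ L ℓ D)
    (hφ : ∀ i, IsOrthogonalScalingFunction (σ i) (h i) (φ i))
    (hg : ∀ i, IsWaveletFilterSystem (σ i) (h i) (g i)) :
    IsOrthonormalWavelets D latticeEmb (fun x => tensorFunction φ (L x))
      (fun (η : {η : ∀ i, ZMod (σ i).natAbs // η ≠ 0}) x =>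
        tensorFunction (fun i =>
          filteredFunction (dil (σ i)) (fun n : ℤ => (n : ℝ)) (g i (η.1 i)) (φ i)) (L x)) := by
  let Φ : ∀ i, ZMod (σ i).natAbs → ℝ → ℝ := fun i k =>
    filteredFunction (dil (σ i)) (fun n : ℤ => (n : ℝ)) (g i k) (φ i)
  have hmem : ∀ i, MemLp (φ i) 2 volume := fun i => (hφ i).2.memLp
  have hΦmem : ∀ i k, MemLp (Φ i k) 2 volume := fun i k =>
    memLp_filteredFunction_dil (hD.ne_zero i) ((hg i).finite_support k) (hmem i)
  have hΦ0 : ∀ i, φ i =ᵐ[volume] Φ i 0 := fun i => by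
    have := (hφ i).1.2
    rwa [← (hg i).lowpass] at this
  have hΦo : ∀ i k l (γ : ℤ), ∫ y, Φ i k y * Φ i l (y - γ) = if k = l ∧ γ = 0 then 1 else 0 :=
    fun i k l γ => integral_wavelet_mul (hg i) (hD.ne_zero i) (hmem i) (hφ i).2.orthonormal k l γ
  have hφΦ : ∀ i k, k ≠ 0 → ∀ γ : ℤ, ∫ y, Φ i k y * φ i (y - γ) = 0 := by
    intro i k hk γ
    have h1 : ∫ y, Φ i k y * φ i (y - γ) = ∫ y, Φ i k y * Φ i 0 (y - γ) := by
      refine integral_congr_ae ?_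
      have h2 : ∀ᵐ y : ℝ, φ i (y - γ) = Φ i 0 (y - γ) :=
        (measurePreserving_sub_right volume (γ : ℝ)).quasiMeasurePreserving.ae (hΦ0 i)
      filter_upwards [h2] with y hy
      rw [hy]
    rw [h1, hΦo, if_neg fun h => hk h.1]
  have hne : ∀ η : {η : ∀ i, ZMod (σ i).natAbs // η ≠ 0}, ∃ i, η.1 i ≠ 0 := fun η =>
    Function.ne_iff.1 η.2
  refine ⟨fun η => memLp_tensorFunction_comp hD.measurePreserving fun i => hΦmem i _,
    fun η γ => ?_, fun η θ γ => ?_, fun j => ?_⟩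
  -- A single coordinate with η i ≠ 0 contributes a vanishing factor.
  · obtain ⟨i, hi⟩ := hne η
    simp_rw [hD.tensorFunction_sub]
    rw [hD.integral_tensorFunction_mul]
    refine Finset.prod_eq_zero (Finset.mem_univ i) ?_
    simp_rw [mul_comm (φ i _)]
    exact hφΦ i _ hi _
  · simp_rw [hD.tensorFunction_sub]
    rw [hD.integral_tensorFunction_mul]
    refine (Finset.prod_congr rfl fun i _ => hΦo i (η.1 i) (θ.1 i) (ℓ γ i)).trans ?_
    rw [prod_ite_and_eq_ite (ℓ γ) (fun i => η.1 i = θ.1 i) (η = θ)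
      (by rw [Subtype.ext_iff, funext_iff])]
    simp
  · refine eq_inf_orthogonal_of_le_closure_sup (isClosed_dilatedSpan _ _ _ _) ?_ ?_ ?_
    · refine dilatedSpan_le (isClosed_dilatedSpan _ _ _ _) fun η α f hf => ?_
      obtain ⟨u, hu, rfl⟩ := hD.exists_eq_tensorLp (fun i => hΦmem i (η.1 i)) hf
      refine hD.tensorLp_mem_scalingSpace fun i => ?_
      rw [← dilatedSpan_filteredFunction_eq (hg i) (hD.ne_zero i) (hmem i)]
      exact mem_dilatedSpan (η.1 i) (ℓ α i) (hu i)
    · refine dilatedSpan_le (Submodule.isClosed_orthogonal _) fun η α f hf => ?_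
      obtain ⟨u, hu, rfl⟩ := hD.exists_eq_tensorLp (fun i => hΦmem i (η.1 i)) hf
      obtain ⟨i, hi⟩ := hne η
      have hi' : scalingSpace (dil (σ i)) (fun n : ℤ => (n : ℝ)) (φ i) j ≤ (ℝ ∙ u i)ᗮ := by
        refine dilatedSpan_le (Submodule.isClosed_orthogonal _) fun _ β v hv => ?_
        rw [Submodule.mem_orthogonal_singleton_iff_inner_right,
          inner_eq_integral_of_ae_eq (hu i) hv]
        have := integral_comp_affine_mul (Φ i (η.1 i)) (φ i) ((σ i : ℝ) ^ j) (ℓ α i) β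
        rw [← Int.cast_sub, hφΦ i _ hi, mul_zero] at this
        exact this
      have hle : scalingSpace D latticeEmb (fun x => tensorFunction φ (L x)) j ≤
          (ℝ ∙ tensorLp hD.measurePreserving u)ᗮ := by
        refine hD.scalingSpace_le hmem (Submodule.isClosed_orthogonal _) fun v hv => ?_
        rw [Submodule.mem_orthogonal_singleton_iff_inner_right, inner_tensorLp]
        exact Finset.prod_eq_zero (Finset.mem_univ i)
          (Submodule.mem_orthogonal_singleton_iff_inner_right.1 (hi' (hv i)))
      intro v hv
      exact Submodule.mem_orthogonal_singleton_iff_inner_left.1 (hle hv)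
    · refine hD.scalingSpace_le hmem (Submodule.isClosed_topologicalClosure _) fun u hu => ?_
      -- Each univariate V_{j+1} is replaced by the closed span of all its filtered families at
      -- level j, so it suffices to treat tensors of single generators, sorted by their index η.
      simp_rw [← dilatedSpan_filteredFunction_eq (hg _) (hD.ne_zero _) (hmem _)] at hu
      refine ContinuousMultilinearMap.mem_of_forall_mem_closure_span _
        (Submodule.isClosed_topologicalClosure _) (fun m hm => ?_) hu
      choose η β hβ using hm
      refine Submodule.le_topologicalClosure _ ?_
      by_cases hη : η = 0
      · refine Submodule.mem_sup_left (hD.tensorLp_mem_scalingSpace fun i => ?_)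
        refine mem_dilatedSpan () (β i) ((hβ i).trans ?_)
        rw [hη]
        exact (quasiMeasurePreserving_affine (dil_ne_zero (hD.ne_zero i) j) (β i)).ae
          (p := fun y => Φ i 0 y = φ i y) (hΦ0 i).symm
      · exact Submodule.mem_sup_right (hD.tensorLp_mem_dilatedSpan (P := fun η => η ≠ 0)
          (Φ := Φ) ⟨η, hη⟩ β hβ)

end DiagonalCoordinates

end TensorMRA

/-! ### The coordinates given by a Smith factorization -/

section Smith

variable {s : ℕ} {Ξ Θ₁ Θ₂ : Matrix (Fin s) (Fin s) ℤ} {σ : Fin s → ℤ}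

lemma map_intCast_mul (A B : Matrix (Fin s) (Fin s) ℤ) :
    (A * B).map (Int.cast : ℤ → ℝ) = A.map (Int.cast : ℤ → ℝ) * B.map (Int.cast : ℤ → ℝ) :=
  Matrix.map_mul (f := Int.castRingHom ℝ)

lemma map_mul_map_eq_one {A B : Matrix (Fin s) (Fin s) ℤ} (h : A * B = 1) :
    A.map (Int.cast : ℤ → ℝ) * B.map (Int.cast : ℤ → ℝ) = 1 := by
  rw [← map_intCast_mul, h, Matrix.map_one _ Int.cast_zero Int.cast_one]

/-- The linear change of coordinates `x ↦ Θ₂ x`, for `Θ₂ = Θ₁⁻¹`. -/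
def smithCoordinates (hΘ : Θ₂ * Θ₁ = 1) : (Fin s → ℝ) ≃ᵐ (Fin s → ℝ) where
  toFun x := Θ₂.map (Int.cast : ℤ → ℝ) *ᵥ x
  invFun x := Θ₁.map (Int.cast : ℤ → ℝ) *ᵥ x
  left_inv x := by
    beta_reduce
    rw [Matrix.mulVec_mulVec, map_mul_map_eq_one (mul_eq_one_comm.1 hΘ), Matrix.one_mulVec]
  right_inv x := by
    beta_reduce
    rw [Matrix.mulVec_mulVec, map_mul_map_eq_one hΘ, Matrix.one_mulVec]
  measurable_toFun := (Continuous.matrix_mulVec continuous_const continuous_id).measurable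
  measurable_invFun := (Continuous.matrix_mulVec continuous_const continuous_id).measurable

lemma smithCoordinates_apply (hΘ : Θ₂ * Θ₁ = 1) (x : Fin s → ℝ) :
    smithCoordinates hΘ x = Θ₂.map (Int.cast : ℤ → ℝ) *ᵥ x := rfl

/-- The action of `Θ₂` on the lattice. -/
def smithLatticeEquiv (hΘ : Θ₂ * Θ₁ = 1) : (Fin s → ℤ) ≃+ (Fin s → ℤ) where
  toFun x := Θ₂ *ᵥ x
  invFun x := Θ₁ *ᵥ x
  left_inv x := by
    beta_reduce
    rw [Matrix.mulVec_mulVec, mul_eq_one_comm.1 hΘ, Matrix.one_mulVec]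
  right_inv x := by
    beta_reduce
    rw [Matrix.mulVec_mulVec, hΘ, Matrix.one_mulVec]
  map_add' x y := Matrix.mulVec_add _ x y

lemma smithLatticeEquiv_apply (hΘ : Θ₂ * Θ₁ = 1) (α : Fin s → ℤ) :
    smithLatticeEquiv hΘ α = Θ₂ *ᵥ α := rfl

lemma measurePreserving_smithCoordinates (hΘ : Θ₂ * Θ₁ = 1) (hdet : |Θ₂.det| = 1) :
    MeasurePreserving (smithCoordinates hΘ) volume volume := by
  refine ⟨(smithCoordinates hΘ).measurable, ?_⟩
  have hd : (Θ₂.map (Int.cast : ℤ → ℝ)).det = (Θ₂.det : ℝ) := by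
    rw [Int.cast_det]
  have habs : |(Θ₂.det : ℝ)| = 1 := by exact_mod_cast hdet
  have hne : (Θ₂.map (Int.cast : ℤ → ℝ)).det ≠ 0 := by
    rw [hd]; intro h0; rw [h0] at habs; simp at habs
  have := Real.map_matrix_volume_pi_eq_smul_volume_pi hne
  rw [hd, abs_inv, habs] at this
  rw [inv_one, ENNReal.ofReal_one, one_smul] at this
  exact this

lemma diagonal_zpow_mulVec (d : Fin s → ℝ) (hd : ∀ i, d i ≠ 0) (j : ℤ) (x : Fin s → ℝ)
    (i : Fin s) : (Matrix.diagonal d ^ j *ᵥ x) i = d i ^ j * x i := by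
  have : Matrix.diagonal d ^ j = Matrix.diagonal (fun i => d i ^ j) := by
    cases j with
    | ofNat n => simp [Matrix.diagonal_pow, Pi.pow_def]
    | negSucc n =>
      rw [zpow_negSucc, Matrix.diagonal_pow]
      refine Matrix.inv_eq_left_inv ?_
      rw [Matrix.diagonal_mul_diagonal, ← Matrix.diagonal_one]
      congr 1
      ext i
      rw [zpow_negSucc, Pi.pow_apply, inv_mul_cancel₀ (pow_ne_zero _ (hd i))]
  rw [this, Matrix.mulVec_diagonal]

lemma smith_det_eq (hSmith : IsSmithFactorization Ξ Θ₁ σ Θ₂) (hΘ : Θ₂ * Θ₁ = 1) :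
    Ξ.det = ∏ i, σ i := by
  have h1 : Θ₂.det * Θ₁.det = 1 := by rw [← Matrix.det_mul, hΘ, Matrix.det_one]
  rw [hSmith.eq, Matrix.det_mul, Matrix.det_mul, Matrix.det_diagonal]
  linear_combination (∏ i, σ i) * h1

lemma IsExpansive.det_ne_zero (hΞ : IsExpansive Ξ) : Ξ.det ≠ 0 := by
  intro h0
  have hmem : (0 : ℂ) ∈ spectrum ℂ (Ξ.map (Int.cast : ℤ → ℂ)) := by
    rw [spectrum.zero_mem_iff, Matrix.isUnit_iff_isUnit_det, isUnit_iff_ne_zero, not_not]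
    have : (Ξ.map (Int.cast : ℤ → ℂ)).det = (Ξ.det : ℂ) := by rw [Int.cast_det]
    rw [this, h0, Int.cast_zero]
  have := hΞ 0 hmem
  norm_num at this

lemma diagonalCoordinates_smith (hΞ : IsExpansive Ξ)
    (hSmith : IsSmithFactorization Ξ Θ₁ σ Θ₂) (hΘ : Θ₂ * Θ₁ = 1) :
    DiagonalCoordinates σ (smithCoordinates hΘ) (smithLatticeEquiv hΘ) (matDil Ξ) := by
  have hdet := hΞ.det_ne_zero
  have hdet' := hdet
  rw [smith_det_eq hSmith hΘ] at hdet
  have hσ : ∀ i, σ i ≠ 0 := fun i => Finset.prod_ne_zero_iff.1 hdet i (Finset.mem_univ i)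
  refine ⟨measurePreserving_smithCoordinates hΘ hSmith.unimodular_right, hσ,
    fun x α i => ?_, fun j x i => ?_⟩
  · rw [smithCoordinates_apply, smithCoordinates_apply, smithLatticeEquiv_apply,
      Matrix.mulVec_sub, Pi.sub_apply]
    congr 1
    simp [Matrix.mulVec, dotProduct, latticeEmb]
  · have hsemi : SemiconjBy (Θ₂.map (Int.cast : ℤ → ℝ)) (Ξ.map (Int.cast : ℤ → ℝ))
        (Matrix.diagonal fun i => (σ i : ℝ)) := by
      -- The hypothesis Θ₂ Θ₁ = I removes the factor Θ₂ Θ₁ in front of Σ; since both dilations are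
      -- invertible, the intertwining passes to negative powers too.
      have h1 : Θ₂ * Ξ = Matrix.diagonal σ * Θ₂ := by
        rw [hSmith.eq, ← Matrix.mul_assoc, ← Matrix.mul_assoc, hΘ, Matrix.one_mul]
      have := congrArg (fun M => M.map (Int.cast : ℤ → ℝ)) h1
      simp only [map_intCast_mul] at this
      rw [Matrix.diagonal_map Int.cast_zero] at this
      exact this
    have h2 := Matrix.SemiconjBy.zpow_right (m := j) ?_ ?_ hsemi
    · rw [smithCoordinates_apply, smithCoordinates_apply, matDil, Matrix.mulVec_mulVec, h2.eq,
        ← Matrix.mulVec_mulVec, diagonal_zpow_mulVec _ fun i => Int.cast_ne_zero.2 (hσ i)]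
      rfl
    · have : (Ξ.map (Int.cast : ℤ → ℝ)).det = (Ξ.det : ℝ) := by rw [Int.cast_det]
      rw [this, isUnit_iff_ne_zero]
      exact_mod_cast hdet'
    · rw [Matrix.det_diagonal, isUnit_iff_ne_zero]
      exact_mod_cast hdet

lemma smithScalingFunction_eq (hΘ : Θ₂ * Θ₁ = 1) (φ : Fin s → ℝ → ℝ) :
    smithScalingFunction Θ₁ φ = fun x => tensorFunction φ (smithCoordinates hΘ x) := by
  ext x
  rw [smithScalingFunction, Matrix.inv_eq_left_inv hΘ, smithCoordinates_apply]

lemma finite_support_tensorFilter {g : ∀ j, ZMod (σ j).natAbs → ℤ → ℝ}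
    (hg : ∀ j k, (g j k).support.Finite) (η : ∀ j, ZMod (σ j).natAbs) :
    (tensorFilter g η).support.Finite := by
  refine (Set.Finite.pi' fun j => hg j (η j)).subset fun α hα j => ?_
  exact Finset.prod_ne_zero_iff.1 hα j (Finset.mem_univ j)

lemma finite_support_smithFilter (hΘ : Θ₂ * Θ₁ = 1) {g : ∀ j, ZMod (σ j).natAbs → ℤ → ℝ}
    (hg : ∀ j k, (g j k).support.Finite) (η : ∀ j, ZMod (σ j).natAbs) :
    (smithFilter Θ₁ g η).support.Finite := by
  have : smithFilter Θ₁ g η = fun α => tensorFilter g η (smithLatticeEquiv hΘ α) := by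
    ext α
    rw [smithFilter, Matrix.inv_eq_left_inv hΘ, smithLatticeEquiv_apply]
  rw [this]
  exact Set.Finite.preimage (smithLatticeEquiv hΘ).injective.injOn
    (finite_support_tensorFilter hg η)

/-- The wavelets are tensor products in the Smith coordinates. -/
lemma smithWavelet_eq (hΞ : IsExpansive Ξ) (hSmith : IsSmithFactorization Ξ Θ₁ σ Θ₂)
    (hΘ : Θ₂ * Θ₁ = 1) (φ : Fin s → ℝ → ℝ) {g : ∀ j, ZMod (σ j).natAbs → ℤ → ℝ}
    (hg : ∀ j k, (g j k).support.Finite) (η : ∀ j, ZMod (σ j).natAbs) :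
    smithWavelet Ξ Θ₁ φ g η = fun x => tensorFunction (fun i =>
      filteredFunction (dil (σ i)) (fun n : ℤ => (n : ℝ)) (g i (η i)) (φ i))
        (smithCoordinates hΘ x) := by
  classical
  have hD := diagonalCoordinates_smith hΞ hSmith hΘ
  ext x
  have h1 : smithWavelet Ξ Θ₁ φ g η x = ∑ᶠ β : Fin s → ℤ, ∏ i,
      g i (η i) (β i) * φ i (σ i * smithCoordinates hΘ x i - β i) := by
    rw [smithWavelet, filteredFunction]
    -- Reindexing by β = Θ₂ α makes both the filter and the translated scaling function split into
    -- coordinates.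
    refine finsum_eq_of_bijective _ (smithLatticeEquiv hΘ).bijective fun α => ?_
    rw [smithScalingFunction_eq hΘ]
    beta_reduce
    rw [hD.tensorFunction_dil, smithFilter,
      Matrix.inv_eq_left_inv hΘ, Finset.prod_mul_distrib]
    simp only [tensorFunction, tensorFilter, dil_one, smithLatticeEquiv_apply]
  -- On the finite box of supports, a sum of products over the box is the product of the univariate
  -- sums.
  rw [h1, finsum_eq_sum_of_support_subset
    (s := Fintype.piFinset fun i => (hg i (η i)).toFinset), ← Finset.prod_univ_sum
    (fun i => (hg i (η i)).toFinset)
    (fun i n => g i (η i) n * φ i (σ i * smithCoordinates hΘ x i - n))]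
  · exact Finset.prod_congr rfl fun i _ =>
      (filteredFunction_dil_eq_sum (by simp) (φ i) _).symm
  · intro β hβ
    simp only [Finset.mem_coe, Fintype.mem_piFinset, Set.Finite.mem_toFinset]
    exact fun i => left_ne_zero_of_mul (Finset.prod_ne_zero_iff.1 hβ i (Finset.mem_univ i))

/-- Nonzero σ i excludes `ZMod 0`, which is the infinite ring ℤ; otherwise the index set has ∏ |σ i|
elements, one of them 0. -/
lemma card_wavelet_index (hσ : ∀ i, σ i ≠ 0) :
    Nat.card {η : ∀ j, ZMod (σ j).natAbs // η ≠ 0} + 1 = (∏ i, σ i).natAbs := by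
  classical
  have : ∀ i, NeZero (σ i).natAbs := fun i => ⟨by simpa using hσ i⟩
  have h1 : Fintype.card (∀ j, ZMod (σ j).natAbs) = (∏ i, σ i).natAbs := by
    rw [Fintype.card_pi]
    simp only [ZMod.card]
    exact (map_prod Int.natAbsHom σ Finset.univ).symm
  rw [Nat.card_eq_fintype_card, Fintype.card_subtype_compl, Fintype.card_subtype_eq, ← h1]
  exact Nat.sub_add_cancel Fintype.card_pos

end Smith

end

theorem theoremT {s : ℕ} (hs : 0 < s)
    (Ξ Θ₁ Θ₂ : Matrix (Fin s) (Fin s) ℤ) (σ : Fin s → ℤ)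
    (hΞ : IsExpansive Ξ)
    (hSmith : IsSmithFactorization Ξ Θ₁ σ Θ₂)
    (hΘ : Θ₂ * Θ₁ = 1)
    (φ : Fin s → ℝ → ℝ) (h : Fin s → ℤ → ℝ)
    (hφ : ∀ j, IsOrthogonalScalingFunction (σ j) (h j) (φ j))
    (g : ∀ j, ZMod (σ j).natAbs → ℤ → ℝ)
    (hg : ∀ j, IsWaveletFilterSystem (σ j) (h j) (g j)) :
    IsRefinable (matDil Ξ) latticeEmb (smithFilter Θ₁ g 0) (smithScalingFunction Θ₁ φ) ∧
    IsOrthogonalMRA (matDil Ξ) latticeEmb (smithScalingFunction Θ₁ φ) ∧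
    IsOrthonormalWavelets (matDil Ξ) latticeEmb (smithScalingFunction Θ₁ φ)
      (fun η : {η : ∀ j, ZMod (σ j).natAbs // η ≠ 0} => smithWavelet Ξ Θ₁ φ g η) ∧
    Nat.card {η : ∀ j, ZMod (σ j).natAbs // η ≠ 0} + 1 = Ξ.det.natAbs := by
  have hD := diagonalCoordinates_smith hΞ hSmith hΘ
  have hfin : ∀ j k, (g j k).support.Finite := fun j => (hg j).finite_support
  refine ⟨⟨finite_support_smithFilter hΘ hfin 0, ?_⟩, ?_, ?_, ?_⟩
  · change _ =ᵐ[volume] smithWavelet Ξ Θ₁ φ g 0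
    rw [smithWavelet_eq hΞ hSmith hΘ φ hfin, smithScalingFunction_eq hΘ]
    refine tensorFunction_comp_congr_ae hD.measurePreserving fun i => ?_
    have := (hφ i).1.2
    rwa [← (hg i).lowpass] at this
  · rw [smithScalingFunction_eq hΘ]
    exact hD.isOrthogonalMRA hs fun i => (hφ i).2
  · simp_rw [smithWavelet_eq hΞ hSmith hΘ φ hfin]
    rw [smithScalingFunction_eq hΘ]
    exact hD.isOrthonormalWavelets hφ hg
  · rw [smith_det_eq hSmith hΘ]
    exact card_wavelet_index hD.ne_zero
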